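/- For an abelian group $G$ (written additively), a subset $S\subseteq G$ and an integer $n\ge 1$, put $nS=\{ns : s\in S\}$, and let $\langle S\rangle$ be the subgroup generated by $S$. The group $G$ is torsion if every element has finite order, and unbounded if there is no integer $n\ge 1$ with $nG=\{0\}$. A topological group is precompact if it is topologically isomorphic to a subgroup of a compact Hausdorff group. The set $S$ is potentially dense in $G$ if there is a Hausdorff group topology on $G$ in which $S$ is dense. The set $S$ is $\omega$-wide if $nS\setminus\langle S'\rangle\neq\emptyset$ for every integer $n\ge 1$ and every finite $S'\subseteq S$. Let $G$ be an unbounded torsion abelian group with $|G|\le 2^{\mathfrak c}$, where $\mathfrak c$ is the cardinality of the continuum, and let $S\subseteq G$ be a countable subset. Then the following conditions are equivalent: (i) $S$ is potentially dense in $G$; (ii) there exists a precompact Hausdorff group topology $\mathscr T$ on $G$ such that $S$ is dense in $(G,\mathscr T)$; (iii) $S$ is $\omega$-wide; (iv) the set $nS$ is infinite for every integer $n\ge 1$. -/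

import Mathlib

open Cardinal

universe u

/-- For a subset `S` of an additive group and `n : ℕ`, the set `nS = {n s : s ∈ S}`
(the elementwise multiple, not the `n`-fold sum `S + ⋯ + S`). -/
def setMultiple {G : Type u} [AddGroup G] (n : ℕ) (S : Set G) : Set G :=
  (fun x : G => n • x) '' S

/-- An abelian group `G` is bounded if `nG = {0}` for some positive integer `n`. -/
def IsBoundedGroup (G : Type u) [AddGroup G] : Prop :=
  ∃ n : ℕ, 0 < n ∧ setMultiple n (Set.univ : Set G) = {0}

/-- `S` is `τ`-wide: for every positive integer `n` and every `S' ⊆ S` with `|S'| < τ`, the set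
`nS` is not contained in the subgroup generated by `S'`. -/
def IsWide {G : Type u} [AddGroup G] (τ : Cardinal.{u}) (S : Set G) : Prop :=
  ∀ n : ℕ, 0 < n → ∀ S' : Set G, S' ⊆ S → #S' < τ →
    (setMultiple n S \ (AddSubgroup.closure S' : Set G)).Nonempty

/-- A topological group is precompact if it is (topologically) isomorphic to a subgroup of some
compact Hausdorff group. -/
def IsPrecompactGroup (G : Type u) [AddGroup G] [TopologicalSpace G] : Prop :=
  ∃ (K : Type u) (_ : AddGroup K) (_ : TopologicalSpace K) (φ : G →+ K),
    IsTopologicalAddGroup K ∧ CompactSpace K ∧ T2Space K ∧ Topology.IsEmbedding φ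

/-- `S` is potentially dense in `G`: it is dense in some Hausdorff group topology on `G`. -/
def IsPotentiallyDense {G : Type u} [AddGroup G] (S : Set G) : Prop :=
  ∃ _ : TopologicalSpace G, IsTopologicalAddGroup G ∧ T2Space G ∧ Dense S

/-- `S` is dense in some precompact Hausdorff group topology on `G`. -/
def IsPrecompactlyPotentiallyDense {G : Type u} [AddGroup G] (S : Set G) : Prop :=
  ∃ _ : TopologicalSpace G,
    IsTopologicalAddGroup G ∧ T2Space G ∧ IsPrecompactGroup G ∧ Dense S

/-!
Only the passage from a wide set `S` to a precompact topology needs work. It amounts to finding an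
injective homomorphism `φ` from `G` into a power `𝕋 ^ J` of the circle `𝕋` such that `φ '' S` is
dense in `𝕋 ^ J`; the topology induced by `φ` is then as required.

Wideness yields a sequence `s k` in `S` whose order modulo the finite subgroup `B k` generated by
the preceding terms tends to infinity (`IsWide.exists_seq`). The values of a character at `s k`
compatible with its values on `B k` form a coset of a subgroup of `𝕋` with small gaps, so characters
of `G` can be made to follow any prescribed sequence of points of `𝕋` along `s`, with error tending
to zero, even when they are prescribed in advance on a subgroup `A` modulo which the `s k` keep
their large order (`exists_character_eqOn_tendsto`). If `J` has at most continuum many elements,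
some sequence in `𝕋 ^ J` clusters everywhere (`exists_seq_forall_mapClusterPt`); letting the
characters follow its coordinates makes `φ '' S` dense.

Injectivity comes in two stages (`IsWide.exists_injective_seq_mapClusterPt`). Countably many
coordinates separate the points of `H`, the union of the `B k`. Their common kernel `K` satisfies
`K ∩ H = 0`, so on `K` the remaining coordinates are free. As `G` has at most `2 ^ 𝔠` elements, its
elements of prime order `p` form a vector space that embeds into `(ZMod p) ^ 𝔠`, so continuum many
characters detect them (`exists_characters_separating_torsionBy`); taking these for all `p` as
the prescribed restrictions to `K` makes `φ` injective, since a nontrivial torsion group has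
elements of prime order.
-/

open Filter Topology

/-! ### Extending characters of a torsion group -/

/-- Every character of a subgroup extends to the whole group, the circle being divisible. -/
theorem exists_character_extension {A G : Type*} [AddCommGroup A] [AddCommGroup G]
    (f : A →+ G) (hf : Function.Injective f) (χ : A →+ UnitAddCircle) :
    ∃ η : G →+ UnitAddCircle, ∀ a, η (f a) = χ a := by
  obtain ⟨η, hη⟩ := (Module.Baer.of_divisible UnitAddCircle).extension_property_addMonoidHom f hf χ
  exact ⟨η, fun a => DFunLike.congr_fun hη a⟩

/-- The only constraint on the value of a character at `q` comes from the order of `q`; an element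
of infinite order has `addOrderOf q = 0`, which imposes none. -/
theorem exists_character_apply_eq {Q : Type*} [AddCommGroup Q] (q : Q) (w : UnitAddCircle)
    (hw : addOrderOf q • w = 0) : ∃ η : Q →+ UnitAddCircle, η q = w := by
  let f : ZMod (addOrderOf q) →+ Q := ZMod.lift (addOrderOf q)
    ⟨zmultiplesHom Q q, by simp [addOrderOf_nsmul_eq_zero]⟩
  let g : ZMod (addOrderOf q) →+ UnitAddCircle := ZMod.lift (addOrderOf q)
    ⟨zmultiplesHom UnitAddCircle w, by simpa using hw⟩
  have hf : Function.Injective f := by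
    refine (ZMod.lift_injective _).2 fun m hm => ?_
    rw [CharP.intCast_eq_zero_iff (ZMod (addOrderOf q)) (addOrderOf q)]
    exact addOrderOf_dvd_iff_zsmul_eq_zero.2 (by simpa using hm)
  obtain ⟨η, hη⟩ := exists_character_extension f hf g
  refine ⟨η, ?_⟩
  have h1 := hη ((1 : ℤ) : ZMod (addOrderOf q))
  simpa [f, g, -Int.cast_one] using h1

theorem exists_character_apply_ne_zero {Q : Type*} [AddCommGroup Q] {q : Q}
    (hq : IsOfFinAddOrder q) : ∃ η : Q →+ UnitAddCircle, q ≠ 0 → η q ≠ 0 := by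
  have hm := hq.addOrderOf_pos
  have hord := AddCircle.addOrderOf_period_div (p := (1 : ℝ)) hm
  obtain ⟨η, hη⟩ := exists_character_apply_eq q
    (((1 : ℝ) / (addOrderOf q : ℝ) : ℝ) : UnitAddCircle) (by
      rw [← addOrderOf_dvd_iff_nsmul_eq_zero]
      exact hord.dvd)
  refine ⟨η, fun hq0 h0 => hq0 ?_⟩
  rw [hη] at h0
  rw [h0, addOrderOf_zero] at hord
  exact AddMonoid.addOrderOf_eq_one_iff.1 hord.symm

/-- The values that characters take at an element of order greater than `N` form a subgroup of the
circle with gaps of length at most `1 / (N + 1)`. -/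
theorem exists_character_dist_le {Q : Type*} [AddCommGroup Q] {q : Q} (hq : IsOfFinAddOrder q)
    {N : ℕ} (hN : N < addOrderOf q) (u : UnitAddCircle) :
    ∃ η : Q →+ UnitAddCircle, dist (η q) u ≤ 1 / ((N : ℝ) + 1) := by
  set m := addOrderOf q with hm
  have hm0 : (0 : ℝ) < m := by exact_mod_cast hq.addOrderOf_pos
  obtain ⟨r, rfl⟩ := QuotientAddGroup.mk_surjective u
  -- The largest multiple of `1 / m` not exceeding `r` is within `1 / m` of it.
  obtain ⟨η, hη⟩ := exists_character_apply_eq q (((⌊r * m⌋ : ℝ) / m : ℝ) : UnitAddCircle) (by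
    rw [← hm, ← AddCircle.coe_nsmul, nsmul_eq_mul, mul_div_cancel₀ _ hm0.ne']
    exact (AddCircle.coe_eq_zero_iff 1).2 ⟨⌊r * m⌋, by simp⟩)
  refine ⟨η, ?_⟩
  rw [hη, dist_comm, dist_eq_norm]
  have h1 : ‖((r - (⌊r * m⌋ : ℝ) / m : ℝ) : UnitAddCircle)‖ ≤ ‖r - (⌊r * m⌋ : ℝ) / m‖ :=
    QuotientAddGroup.norm_mk_le_norm
  have h2 : r - (⌊r * m⌋ : ℝ) / m = Int.fract (r * m) / m := by
    rw [← Int.self_sub_floor]; field_simp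
  refine h1.trans ?_
  rw [h2, Real.norm_of_nonneg (div_nonneg (Int.fract_nonneg _) hm0.le)]
  have h3 : (N : ℝ) + 1 ≤ m := by exact_mod_cast hN
  exact div_le_div₀ zero_le_one (Int.fract_lt_one _).le (by positivity) h3

/-- A character can be modified, without changing it on the subgroup `B`, so as to take almost any
prescribed value at an element `s` of large order modulo `B`. -/
theorem exists_character_eqOn_dist_le {G : Type*} [AddCommGroup G] (htors : IsAddTorsion G)
    (B : AddSubgroup G) (χ : G →+ UnitAddCircle) (s : G) (N : ℕ)
    (hs : ∀ n, 0 < n → n ≤ N → n • s ∉ B) (u : UnitAddCircle) :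
    ∃ χ' : G →+ UnitAddCircle, (∀ b ∈ B, χ' b = χ b) ∧ dist (χ' s) u ≤ 1 / ((N : ℝ) + 1) := by
  have hfin : IsOfFinAddOrder (QuotientAddGroup.mk' B s) :=
    (QuotientAddGroup.mk' B).isOfFinAddOrder (htors s)
  obtain ⟨η, hη⟩ := exists_character_dist_le hfin (N := N) (by
    by_contra! hle
    refine hs _ hfin.addOrderOf_pos hle ?_
    rw [← QuotientAddGroup.eq_zero_iff]
    exact addOrderOf_nsmul_eq_zero (QuotientAddGroup.mk' B s)) (u - χ s)
  refine ⟨χ + η.comp (QuotientAddGroup.mk' B), fun b hb => ?_, ?_⟩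
  · have : QuotientAddGroup.mk' B b = 0 := (QuotientAddGroup.eq_zero_iff b).2 hb
    simp only [AddMonoidHom.add_apply, AddMonoidHom.comp_apply, this, map_zero, add_zero]
  · rw [dist_eq_norm] at hη ⊢
    convert hη using 2
    simp only [AddMonoidHom.add_apply, AddMonoidHom.comp_apply]
    abel

/-- Let `B 0 ≤ B 1 ≤ ⋯` with `s k ∈ B (k + 1)`. If the order of `s k` modulo `A ⊔ B k` grows with
`k`, then every character of `A` extends to a character of `G` that follows a given sequence `t`
along `s`. Finitely many of the approximations are obtained one at a time; all of them
together come from the compactness of the space of characters. -/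
theorem exists_character_eqOn_tendsto {G : Type*} [AddCommGroup G] (htors : IsAddTorsion G)
    {s : ℕ → G} {B : ℕ → AddSubgroup G} (hB : Monotone B) (hsB : ∀ k, s k ∈ B (k + 1))
    (A : AddSubgroup G) (χ : G →+ UnitAddCircle) (k₀ : ℕ)
    (hs : ∀ k, k₀ ≤ k → ∀ n, 0 < n → n ≤ k → n • s k ∉ A ⊔ B k) (t : ℕ → UnitAddCircle) :
    ∃ η : G →+ UnitAddCircle, (∀ a ∈ A, η a = χ a) ∧
      Tendsto (fun k => η (s k) - t k) atTop (𝓝 0) := by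
  let C : ℕ → Set (G → UnitAddCircle) := fun N =>
    {f | (∀ x y, f (x + y) = f x + f y) ∧ (∀ a ∈ A, f a = χ a) ∧
      ∀ k, k₀ ≤ k → k < N → dist (f (s k)) (t k) ≤ 1 / ((k : ℝ) + 1)}
  have hclosed : ∀ N, IsClosed (C N) := by
    intro N
    simp only [C, Set.ofPred_and, Set.ofPred_forall]
    refine ((isClosed_iInter fun x => isClosed_iInter fun y => isClosed_eq (by fun_prop)
      (by fun_prop)).inter ((isClosed_iInter fun a => isClosed_iInter fun _ =>
      isClosed_eq (by fun_prop) (by fun_prop)).inter (isClosed_iInter fun k =>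
      isClosed_iInter fun _ => isClosed_iInter fun _ => isClosed_le (by fun_prop) (by fun_prop))))
  have hne : ∀ N, ∃ f : G →+ UnitAddCircle, (f : G → UnitAddCircle) ∈ C N := by
    intro N
    induction N with
    | zero => exact ⟨χ, map_add χ, fun _ _ => rfl, by simp⟩
    | succ N ih =>
      obtain ⟨f, -, hfA, hf⟩ := ih
      by_cases hN : k₀ ≤ N
      · obtain ⟨f', hf'B, hf's⟩ :=
          exists_character_eqOn_dist_le htors (A ⊔ B N) f (s N) N (hs N hN) (t N)
        refine ⟨f', map_add f', fun a ha => ?_, fun k hk hkN => ?_⟩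
        · rw [hf'B a (AddSubgroup.mem_sup_left ha), hfA a ha]
        · rcases Nat.lt_succ_iff_lt_or_eq.1 hkN with h | rfl
          · rw [hf'B _ (AddSubgroup.mem_sup_right (hB h (hsB k)))]
            exact hf k hk h
          · exact hf's
      · exact ⟨f, map_add f, hfA, fun k hk hkN => by omega⟩
  obtain ⟨f, hf⟩ := IsCompact.nonempty_iInter_of_sequence_nonempty_isCompact_isClosed C
    (fun N f hf => ⟨hf.1, hf.2.1, fun k hk hkN => hf.2.2 k hk (by omega)⟩)
    (fun N => let ⟨f, hf⟩ := hne N; ⟨f, hf⟩) (hclosed 0).isCompact hclosed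
  rw [Set.mem_iInter] at hf
  refine ⟨AddMonoidHom.mk' f (hf 0).1, (hf 0).2.1, ?_⟩
  refine squeeze_zero_norm' ?_ (tendsto_one_div_add_atTop_nhds_zero_nat (𝕜 := ℝ))
  filter_upwards [eventually_ge_atTop k₀] with k hk
  rw [← dist_eq_norm]
  exact (hf (k + 1)).2.2 k hk (Nat.lt_succ_self k)

/-! ### Dense sequences in powers of the circle -/

/-- A power of a separable space with at most continuum many factors contains a sequence that
clusters at every point (Hewitt–Marczewski–Pondiczery). With the factors labelled by points of the
Cantor space, the terms of the sequence are the functions of the label that depend only on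
finitely many of its bits and take values in a countable dense set. -/
theorem exists_seq_forall_mapClusterPt {J X : Type*} [TopologicalSpace X]
    [TopologicalSpace.SeparableSpace X] [Nonempty X] (e : J → ℕ → Bool)
    (he : Function.Injective e) :
    ∃ t : ℕ → J → X, ∀ x, MapClusterPt x atTop t := by
  classical
  obtain ⟨g, hg⟩ := exists_surjective_nat (Σ n : ℕ, ((Fin n → Bool) → ℕ))
  let F : (Σ n : ℕ, ((Fin n → Bool) → ℕ)) → J → X :=
    fun a j => TopologicalSpace.denseSeq X (a.2 fun i => e j i)
  -- Through `Nat.unpair`, every term of the dense family occurs infinitely often.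
  refine ⟨fun k => F (g k.unpair.1), fun x => mapClusterPt_iff_frequently.2 fun U hU => ?_⟩
  obtain ⟨I, V, hV, hVU⟩ : ∃ I : Finset J, ∃ V : J → Set X, (∀ j, V j ∈ 𝓝 (x j)) ∧
      (I : Set J).pi V ⊆ U := by
    rw [nhds_pi, Filter.mem_pi'] at hU
    exact hU
  have hd : ∀ j, ∃ d, TopologicalSpace.denseSeq X d ∈ V j := fun j =>
    (TopologicalSpace.denseRange_denseSeq X).exists_mem_open isOpen_interior
      ⟨x j, mem_interior_iff_mem_nhds.2 (hV j)⟩ |>.imp fun _ h => interior_subset h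
  choose d hd using hd
  -- Finitely many labels are told apart by their first `n` bits, for `n` large.
  have hsep : ∀ᶠ n : ℕ in atTop, ∀ i ∈ I, ∀ j ∈ I,
      (fun l : Fin n => e i l) = (fun l : Fin n => e j l) → i = j := by
    refine (Filter.eventually_all_finset I).2 fun i _ =>
      (Filter.eventually_all_finset I).2 fun j _ => ?_
    by_cases hij : i = j
    · exact Eventually.of_forall fun _ _ => hij
    · obtain ⟨l, hl⟩ := Function.ne_iff.1 (he.ne hij)
      filter_upwards [eventually_gt_atTop l] with n hn h
      exact absurd (congrFun h ⟨l, hn⟩) hl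
  obtain ⟨n, hn⟩ := hsep.exists
  let f : (Fin n → Bool) → ℕ := fun b =>
    if h : ∃ j ∈ I, (fun l : Fin n => e j l) = b then d h.choose else 0
  have hf : ∀ j ∈ I, f (fun l => e j l) = d j := by
    intro j hj
    have h : ∃ i ∈ I, (fun l : Fin n => e i l) = fun l : Fin n => e j l := ⟨j, hj, rfl⟩
    simp only [f, dif_pos h]
    rw [hn _ h.choose_spec.1 _ hj h.choose_spec.2]
  obtain ⟨a, ha⟩ := hg ⟨n, f⟩
  refine Filter.frequently_atTop.2 fun k => ⟨Nat.pair a k, Nat.right_le_pair a k, hVU ?_⟩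
  intro j hj
  simp only [Nat.unpair_pair, ha, F]
  rw [hf j hj]
  exact hd j

theorem MapClusterPt.of_tendsto_sub {X : Type*} [TopologicalSpace X] [AddCommGroup X]
    [IsTopologicalAddGroup X] {u v : ℕ → X} {x : X} (hv : MapClusterPt x atTop v)
    (huv : Tendsto (fun k => u k - v k) atTop (𝓝 0)) : MapClusterPt x atTop u := by
  refine mapClusterPt_iff_frequently.2 fun U hU => ?_
  have hadd : Tendsto (fun p : X × X => p.1 + p.2) (𝓝 x ×ˢ 𝓝 0) (𝓝 x) := by
    simpa [nhds_prod_eq] using (continuous_add (M := X)).tendsto (x, 0)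
  obtain ⟨V, hV, W, hW, hVW⟩ := Filter.mem_prod_iff.1 (hadd hU)
  refine ((mapClusterPt_iff_frequently.1 hv V hV).and_eventually (huv hW)).mono ?_
  rintro k ⟨hk, hk'⟩
  simpa using hVW (Set.mk_mem_prod hk hk')

/-! ### Separating the points of a group of cardinality at most `2 ^ 𝔠` -/

/-- The elements killed by a prime `p` are separated by continuum many characters: the vector space
`(ZMod p) ^ 𝔠` has dimension `2 ^ 𝔠`, so they embed into it, and `ZMod p` embeds into the circle. -/
theorem exists_characters_separating_torsionBy {G : Type u} [AddCommGroup G]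
    (hcard : #G ≤ 2 ^ continuum.{u}) (p : ℕ) [Fact p.Prime] :
    ∃ ψ : ULift.{u} (ℕ → Bool) → G →+ UnitAddCircle,
      ∀ g : G, p • g = 0 → (∀ r, ψ r g = 0) → g = 0 := by
  have hR : #(ULift.{u} (ℕ → Bool)) = continuum.{u} := by simp
  let _ : Module (ZMod p) (AddSubgroup.torsionBy G (p : ℤ)) := AddSubgroup.torsionBy.zmodModule
  have hrank : Module.rank (ZMod p) (AddSubgroup.torsionBy G (p : ℤ)) ≤
      Module.rank (ZMod p) (ULift.{u} (ℕ → Bool) → ZMod p) := by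
    rw [rank_fun_infinite]
    calc _ ≤ #(AddSubgroup.torsionBy G (p : ℤ)) := rank_le_card _ _
      _ ≤ #G := Cardinal.mk_subtype_le _
      _ ≤ 2 ^ continuum.{u} := hcard
      _ ≤ Cardinal.lift.{u} #(ZMod p) ^ continuum.{u} :=
        Cardinal.power_le_power_right (by
          have : 2 ≤ #(ZMod p) := Cardinal.two_le_iff.2 (exists_pair_ne _)
          simpa using Cardinal.lift_le.{u}.2 this)
      _ = _ := by rw [Cardinal.mk_arrow, hR, Cardinal.lift_continuum]
  obtain ⟨L, hL⟩ := rank_le_iff_exists_linearMap.1 hrank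
  have hext : ∀ r, ∃ η : G →+ UnitAddCircle, ∀ a : AddSubgroup.torsionBy G (p : ℤ),
      η a = ZMod.toAddCircle (L a r) := fun r =>
    exists_character_extension (AddSubgroup.torsionBy G (p : ℤ)).subtype
      Subtype.val_injective
      (ZMod.toAddCircle.comp ((Pi.evalAddMonoidHom _ r).comp L.toAddMonoidHom))
  choose ψ hψ using hext
  refine ⟨ψ, fun g hg h0 => ?_⟩
  have hmem : g ∈ AddSubgroup.torsionBy G (p : ℤ) := by
    simpa [AddSubgroup.torsionBy] using hg
  have hLg : L ⟨g, hmem⟩ = 0 := funext fun r =>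
    ZMod.toAddCircle_injective p (by rw [← hψ r ⟨g, hmem⟩, h0 r]; simp)
  simpa using (map_eq_zero_iff L hL).1 hLg

/-! ### Precompact topologies in which a wide set is dense -/

/-- Wideness for the multiplier `k !` handles all multipliers `n ≤ k` at once. -/
theorem IsWide.exists_forall_nsmul_notMem {G : Type u} [AddCommGroup G] {S : Set G}
    (hS : IsWide ℵ₀ S) {F : Set G} (hFS : F ⊆ S) (hF : F.Finite) (k : ℕ) :
    ∃ s ∈ S, ∀ n, 0 < n → n ≤ k → n • s ∉ AddSubgroup.closure F := by
  obtain ⟨x, ⟨s, hs, hsx⟩, hx⟩ := hS k.factorial k.factorial_pos F hFS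
    (Cardinal.lt_aleph0_iff_set_finite.2 hF)
  refine ⟨s, hs, fun n hn hnk hmem => hx ?_⟩
  obtain ⟨c, hc⟩ := Nat.dvd_factorial hn hnk
  rw [← hsx, SetLike.mem_coe]
  beta_reduce
  rw [hc, mul_nsmul]
  exact AddSubgroup.nsmul_mem _ hmem c

/-- A wide subset contains a sequence whose terms have growing order modulo the finite subgroups
`B k` generated by the preceding terms. -/
theorem IsWide.exists_seq {G : Type u} [AddCommGroup G] (htors : IsAddTorsion G) {S : Set G}
    (hS : IsWide ℵ₀ S) : ∃ (s : ℕ → G) (B : ℕ → AddSubgroup G), (∀ k, s k ∈ S) ∧ Monotone B ∧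
      (∀ k, Finite (B k)) ∧ (∀ k, s k ∈ B (k + 1)) ∧
      ∀ k n, 0 < n → n ≤ k → n • s k ∉ B k := by
  let P := {F : Set G // F ⊆ S ∧ F.Finite}
  choose f hfS hf using fun (F : P) (k : ℕ) => hS.exists_forall_nsmul_notMem F.2.1 F.2.2 k
  let step : ℕ → P → P := fun k F =>
    ⟨insert (f F k) F.1, Set.insert_subset (hfS F k) F.2.1, F.2.2.insert _⟩
  obtain ⟨F, hF⟩ : ∃ F : ℕ → P, ∀ k, F (k + 1) = step k (F k) :=
    ⟨fun k => Nat.rec ⟨∅, Set.empty_subset S, Set.finite_empty⟩ step k, fun _ => rfl⟩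
  have hF' : ∀ k, (F (k + 1)).1 = insert (f (F k) k) (F k).1 := fun k => by rw [hF k]
  refine ⟨fun k => f (F k) k, fun k => AddSubgroup.closure (F k).1,
    fun k => hfS (F k) k, ?_, fun k => ?_, fun k => ?_, fun k => hf (F k) k⟩
  · refine monotone_nat_of_le_succ fun k => AddSubgroup.closure_mono ?_
    rw [hF']
    exact Set.subset_insert _ _
  · have : Finite (F k).1 := (F k).2.2
    exact AddCommGroup.finite_of_fg_isAddTorsion _ fun x =>
      AddSubmonoid.isOfFinAddOrder_coe.1 (htors x)
  · refine AddSubgroup.subset_closure ?_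
    rw [hF']
    exact Set.mem_insert _ _

/-- The core of the construction: an embedding of `G` into a power of the circle which carries a
sequence in `S` to a sequence clustering everywhere. The coordinates indexed by `ℕ` separate the
points of the countable subgroup generated by `s`. Their common kernel `K` meets that subgroup
trivially, so the remaining coordinates can be prescribed on `K`, where they separate points. -/
theorem IsWide.exists_injective_seq_mapClusterPt {G : Type u} [AddCommGroup G]
    (htors : IsAddTorsion G) (hcard : #G ≤ 2 ^ continuum.{u}) {S : Set G} (hS : IsWide ℵ₀ S) :
    ∃ (J : Type u) (φ : G →+ (J → UnitAddCircle)) (s : ℕ → G), Function.Injective φ ∧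
      (∀ k, s k ∈ S) ∧ ∀ x, MapClusterPt x atTop (φ ∘ s) := by
  obtain ⟨s, B, hsS, hB, hfin, hsB, hs⟩ := hS.exists_seq htors
  obtain ⟨e⟩ : Nonempty (ℕ ⊕ (Nat.Primes × ULift.{u} (ℕ → Bool)) ↪ (ℕ → Bool)) := by
    rw [← Cardinal.lift_mk_le']
    simp
  obtain ⟨t, ht⟩ := exists_seq_forall_mapClusterPt (X := UnitAddCircle) e e.injective
  have hcount : (⋃ k, (B k : Set G)).Countable :=
    Set.countable_iUnion fun k => (Set.toFinite (B k : Set G)).countable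
  obtain ⟨h, hh⟩ := hcount.exists_eq_range ⟨0, Set.mem_iUnion.2 ⟨0, (B 0).zero_mem⟩⟩
  have hχ : ∀ i, ∃ χ : G →+ UnitAddCircle, (h i ≠ 0 → χ (h i) ≠ 0) ∧
      Tendsto (fun k => χ (s k) - t k (Sum.inl i)) atTop (𝓝 0) := by
    intro i
    obtain ⟨k₀, hk₀⟩ : ∃ k, h i ∈ B k := by
      simpa using hh.symm.subset (Set.mem_range_self i)
    obtain ⟨χ₀, hχ₀⟩ := exists_character_apply_ne_zero (htors (h i))
    obtain ⟨χ, hχA, hχt⟩ := exists_character_eqOn_tendsto htors hB hsB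
      (AddSubgroup.zmultiples (h i)) χ₀ k₀ (fun k hk n hn hnk => by
        rw [sup_eq_right.2 ((AddSubgroup.zmultiples_le_of_mem hk₀).trans (hB hk))]
        exact hs k n hn hnk) (fun k => t k (Sum.inl i))
    exact ⟨χ, by rwa [hχA _ (AddSubgroup.mem_zmultiples _)], hχt⟩
  choose χ hχ0 hχt using hχ
  let K : AddSubgroup G := ⨅ i, (χ i).ker
  have hK : ∀ g, g ∈ K ↔ ∀ i, χ i g = 0 := by simp [K, AddSubgroup.mem_iInf]
  have hKB : ∀ k, ∀ g ∈ K, g ∈ B k → g = 0 := by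
    intro k g hgK hgB
    obtain ⟨i, rfl⟩ := hh.subset (Set.mem_iUnion.2 ⟨k, hgB⟩)
    by_contra hne
    exact hχ0 i hne ((hK _).1 hgK i)
  have hsK : ∀ k n, 0 < n → n ≤ k → n • s k ∉ K ⊔ B k := by
    intro k n hn hnk hmem
    obtain ⟨y, hy, z, hz, hyz⟩ := AddSubgroup.mem_sup.1 hmem
    have hyB : y ∈ B (k + 1) := by
      rw [eq_sub_of_add_eq hyz]
      exact (B (k + 1)).sub_mem ((B (k + 1)).nsmul_mem (hsB k) n) (hB k.le_succ hz)
    rw [hKB _ y hy hyB, zero_add] at hyz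
    exact hs k n hn hnk (hyz ▸ hz)
  have hψ : ∀ p : Nat.Primes, ∃ ψ : ULift.{u} (ℕ → Bool) → G →+ UnitAddCircle,
      ∀ g : G, (p : ℕ) • g = 0 → (∀ r, ψ r g = 0) → g = 0 := fun p =>
    have : Fact (p : ℕ).Prime := ⟨p.2⟩
    exists_characters_separating_torsionBy hcard p
  choose ψ hψ using hψ
  choose ξ hξK hξt using fun q : Nat.Primes × ULift.{u} (ℕ → Bool) =>
    exists_character_eqOn_tendsto htors hB hsB K (ψ q.1 q.2) 0 (fun k _ => hsK k)
      (fun k => t k (Sum.inr q))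
  let φ : G →+ (ℕ ⊕ (Nat.Primes × ULift.{u} (ℕ → Bool)) → UnitAddCircle) :=
    AddMonoidHom.pi (Sum.rec χ ξ)
  refine ⟨_, φ, s, (injective_iff_map_eq_zero φ).2 fun g hg => ?_, hsS, fun x =>
    (ht x).of_tendsto_sub (tendsto_pi_nhds.2 ?_)⟩
  · have hgK : g ∈ K := (hK g).2 fun i => congrFun hg (Sum.inl i)
    by_contra hne
    -- A suitable multiple of `g` has prime order, and it lies in `K`.
    obtain ⟨p, hp, m, hm⟩ := Nat.exists_prime_and_dvd
      (fun h1 => hne (AddMonoid.addOrderOf_eq_one_iff.1 h1) : addOrderOf g ≠ 1)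
    have hm0 : m ≠ 0 := by
      rintro rfl
      exact (htors g).addOrderOf_pos.ne' (by simpa using hm)
    have hmg : m • g = 0 := by
      refine hψ ⟨p, hp⟩ _ ?_ fun r => ?_
      · change p • m • g = 0
        rw [← mul_nsmul', ← hm, addOrderOf_nsmul_eq_zero]
      · rw [← hξK (⟨p, hp⟩, r) _ (K.nsmul_mem hgK m), map_nsmul]
        have : ξ (⟨p, hp⟩, r) g = 0 := congrFun hg (Sum.inr (⟨p, hp⟩, r))
        rw [this, nsmul_zero]
    have hle := addOrderOf_le_of_nsmul_eq_zero (Nat.pos_of_ne_zero hm0) hmg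
    have := Nat.mul_le_mul_right m hp.two_le
    omega
  · rintro (i | q)
    · exact hχt i
    · exact hξt q

theorem IsWide.isPrecompactlyPotentiallyDense {G : Type u} [AddCommGroup G]
    (htors : IsAddTorsion G) (hcard : #G ≤ 2 ^ continuum.{u}) {S : Set G} (hS : IsWide ℵ₀ S) :
    IsPrecompactlyPotentiallyDense S := by
  obtain ⟨J, φ, s, hφ, hsS, hcl⟩ := hS.exists_injective_seq_mapClusterPt htors hcard
  let _ : TopologicalSpace G := TopologicalSpace.induced φ inferInstance
  have hemb : IsEmbedding φ := ⟨⟨rfl⟩, hφ⟩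
  refine ⟨inferInstance, topologicalAddGroup_induced φ, hemb.t2Space,
    ⟨J → UnitAddCircle, inferInstance, inferInstance, φ, inferInstance, inferInstance,
      inferInstance, hemb⟩, fun g => ?_⟩
  rw [closure_induced, mem_closure_iff_clusterPt]
  exact (hcl (φ g)).clusterPt.mono (Filter.le_principal_iff.2
    (Filter.mem_map.2 (Filter.Eventually.of_forall fun k => ⟨s k, hsS k, rfl⟩)))

/-! ### Infinite multiples of potentially dense sets -/

theorem IsPotentiallyDense.setMultiple_infinite {G : Type u} [AddCommGroup G]
    (hunbounded : ¬ IsBoundedGroup G) (htors : IsAddTorsion G) {S : Set G}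
    (hS : IsPotentiallyDense S) (n : ℕ) (hn : 0 < n) : (setMultiple n S).Infinite := by
  obtain ⟨_, _, _, hdense⟩ := hS
  intro hfin
  -- A finite set is closed, so density of `S` forces `nG` to coincide with `nS`.
  have hmem : ∀ g : G, n • g ∈ setMultiple n S := fun g =>
    hfin.isClosed.closure_subset (image_closure_subset_closure_image (continuous_nsmul n)
      (Set.mem_image_of_mem _ (hdense g)))
  -- The orders of the finitely many elements of `nG` have a common multiple.
  refine hunbounded ⟨(∏ x ∈ hfin.toFinset, addOrderOf x) * n,
    Nat.mul_pos (Finset.prod_pos fun x _ => (htors x).addOrderOf_pos) hn, ?_⟩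
  refine Set.eq_singleton_iff_unique_mem.2 ⟨⟨0, trivial, by simp⟩, ?_⟩
  rintro _ ⟨g, -, rfl⟩
  change (_ * n) • g = 0
  rw [mul_nsmul']
  exact addOrderOf_dvd_iff_nsmul_eq_zero.1
    (Finset.dvd_prod_of_mem _ (hfin.mem_toFinset.2 (hmem g)))

theorem IsPrecompactlyPotentiallyDense.isPotentiallyDense {G : Type u} [AddCommGroup G]
    {S : Set G} (hS : IsPrecompactlyPotentiallyDense S) : IsPotentiallyDense S :=
  let ⟨τ, h1, h2, _, h3⟩ := hS
  ⟨τ, h1, h2, h3⟩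

/-- A finitely generated subgroup of a torsion group is finite, so it cannot contain an infinite
set. -/
theorem isWide_aleph0_of_infinite {G : Type u} [AddCommGroup G] (htors : IsAddTorsion G)
    {S : Set G} (hS : ∀ n : ℕ, 0 < n → (setMultiple n S).Infinite) : IsWide ℵ₀ S := by
  intro n hn S' _ hS'
  have : Finite S' := Cardinal.lt_aleph0_iff_finite.1 hS'
  have : Finite (AddSubgroup.closure S') :=
    AddCommGroup.finite_of_fg_isAddTorsion _ fun x =>
      AddSubmonoid.isOfFinAddOrder_coe.1 (htors x)
  exact ((hS n hn).sdiff (Set.toFinite (AddSubgroup.closure S' : Set G))).nonempty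

theorem mainTheorem8 {G : Type u} [AddCommGroup G]
    (htorsion : IsAddTorsion G) (hunbounded : ¬ IsBoundedGroup G)
    (hcard : #G ≤ 2 ^ continuum.{u}) (S : Set G) (hS : S.Countable) :
    List.TFAE
      [ IsPotentiallyDense S,
        IsPrecompactlyPotentiallyDense S,
        IsWide ℵ₀ S,
        ∀ n : ℕ, 0 < n → (setMultiple n S).Infinite ] := by
  tfae_have 1 → 4 := fun h => h.setMultiple_infinite hunbounded htorsion
  tfae_have 4 → 3 := isWide_aleph0_of_infinite htorsion
  tfae_have 3 → 2 := fun h => h.isPrecompactlyPotentiallyDense htorsion hcard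
  tfae_have 2 → 1 := fun h => h.isPotentiallyDense
  tfae_finish
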